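/- Let $\mathcal C$ be a regular category: $\mathcal C$ has finite limits, regular epimorphisms are stable under pullback, and kernel pairs have coequalisers. A relation from $X$ to $Y$ is a subobject $\langle r_1,r_2\rangle : R\rightarrowtail X\times Y$; for a relation $R$ from $X$ to $Y$ and a relation $S$ from $Y$ to $Z$, the composite $SR$ is the image of $(r_1p_1,s_2p_2): R\times_Y S\to X\times Z$, where $R\times_Y S$ (with projections $p_1,p_2$) is the pullback of $r_2$ along $s_1$. An equivalence relation on $X$ is an (internally) reflexive, symmetric and transitive relation from $X$ to $X$. Assume that $\mathcal C$ is a Goursat category, i.e. $RSR=SRS$ for all equivalence relations $R,S$ on the same object. For an arrow $f:X\to Y$ and a relation $R$ on $X$, the regular image $f(R)$ is the relation on $Y$ given by the image of $(f\times f)\circ\langle r_1,r_2\rangle : R\to Y\times Y$. A connector between equivalence relations $R$ and $S$ on $X$ is an arrow $p:R\times_X S\to X$, where $R\times_X S$ is the pullback of $r_2$ along $s_1$, such that, for all generalised elements (arrows into $X$ with a common domain) for which each term is defined, 1. $x\,S\,p(x,y,z)$ and $p(x,y,z)\,R\,z$; 2. $p(x,x,y)=y$; 3. $p(x,y,y)=x$;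 4. $p(x,y,p(z,t,w))=p(p(x,y,z),t,w)$. Proposition. Let $R$ and $S$ be equivalence relations on an object $X$ of $\mathcal C$ and let $f:X\to Y$ be a regular epimorphism. If there exists a connector between $R$ and $S$, then the regular images $f(R)$ and $f(S)$ are equivalence relations on $Y$ and there exists a connector between them. -/

import Mathlib

open CategoryTheory Limits

universe v u

namespace Goursat

variable {C : Type u} [Category.{v} C] [Regular C]

/-- In a regular category the chosen image factorisation of an arrow consists of a regular
epimorphism followed by a monomorphism. -/
theorem isRegularEpi_factorThruImage {A B : C} (g : A ⟶ B) :
    IsRegularEpi (factorThruImage g) := by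
  have := strongEpi_of_strongEpiMonoFactorisation
    (Regular.strongEpiMonoFactorisation g) (Image.isImage g)
  have : StrongEpi (factorThruImage g) := this
  infer_instance

/-- A relation from `X` to `Y` is a subobject of `X × Y`. -/
abbrev Rel (X Y : C) : Type (max u v) := Subobject (X ⨯ Y)

namespace Rel

/-- The first leg `r₁ : R ⟶ X` of a relation. -/
noncomputable abbrev fst {X Y : C} (R : Rel X Y) : (R : C) ⟶ X := R.arrow ≫ prod.fst

/-- The second leg `r₂ : R ⟶ Y` of a relation. -/
noncomputable abbrev snd {X Y : C} (R : Rel X Y) : (R : C) ⟶ Y := R.arrow ≫ prod.snd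

/-- The composite `S R` (first `R`, then `S`): the image of `R ×_Y S ⟶ X × Z`, where `R ×_Y S` is
the pullback of `r₂` along `s₁`. -/
noncomputable def comp {X Y Z : C} (S : Rel Y Z) (R : Rel X Y) : Rel X Z :=
  imageSubobject
    (prod.lift (pullback.fst R.snd S.fst ≫ R.fst) (pullback.snd R.snd S.fst ≫ S.snd))

/-- A relation on `X` is an equivalence relation when its two legs are one in the internal sense:
reflexive, symmetric and transitive. -/
def IsEquiv {X : C} (R : Rel X X) : Prop := IsEquivalenceRelation R.fst R.snd

/-- The regular image `f(R)`: the image of `R ↣ X × X ⟶ Y × Y`, the second arrow being `f × f`. -/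
noncomputable def regularImage {X Y : C} (f : X ⟶ Y) (R : Rel X X) : Rel Y Y :=
  imageSubobject (R.arrow ≫ prod.map f f)

/-- `x R y` for generalised elements `x : T ⟶ X` and `y : T ⟶ Y`: the arrow `(x, y)` factors
through `R`. -/
abbrev Holds {X Y : C} (R : Rel X Y) {T : C} (x : T ⟶ X) (y : T ⟶ Y) : Prop :=
  R.Factors (prod.lift x y)

/-- The generalised element `(x, y, z)` of `R ×_X S` determined by `x R y` and `y S z`. -/
noncomputable def triple {X : C} {R S : Rel X X} {T : C} {x y z : T ⟶ X}
    (hxy : R.Holds x y) (hyz : S.Holds y z) : T ⟶ pullback R.snd S.fst :=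
  pullback.lift (R.factorThru (prod.lift x y) hxy) (S.factorThru (prod.lift y z) hyz)
    (by simp [prod.lift_fst, prod.lift_snd])

end Rel

/-- A connector between two relations `R` and `S` on `X` (to be used for equivalence relations):
an arrow `p : R ×_X S ⟶ X` satisfying the axioms below on all generalised elements for which the
terms are defined. In the comments `p(x, y, z)` is the composite of `(x, y, z)` with `p`. -/
structure IsConnector {X : C} (R S : Rel X X) (p : pullback R.snd S.fst ⟶ X) : Prop where
  /-- `x S p(x, y, z)` -/
  rel_left : ∀ {T : C} (x y z : T ⟶ X) (hxy : R.Holds x y) (hyz : S.Holds y z),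
    S.Holds x (Rel.triple hxy hyz ≫ p)
  /-- `p(x, y, z) R z` -/
  rel_right : ∀ {T : C} (x y z : T ⟶ X) (hxy : R.Holds x y) (hyz : S.Holds y z),
    R.Holds (Rel.triple hxy hyz ≫ p) z
  /-- `p(x, x, y) = y` -/
  map_left : ∀ {T : C} (x y : T ⟶ X) (hxx : R.Holds x x) (hxy : S.Holds x y),
    Rel.triple hxx hxy ≫ p = y
  /-- `p(x, y, y) = x` -/
  map_right : ∀ {T : C} (x y : T ⟶ X) (hxy : R.Holds x y) (hyy : S.Holds y y),
    Rel.triple hxy hyy ≫ p = x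
  /-- `p(x, y, p(z, t, w)) = p(p(x, y, z), t, w)` -/
  assoc : ∀ {T : C} (x y z t w : T ⟶ X)
    (hxy : R.Holds x y) (hyz : S.Holds y z) (hzt : R.Holds z t) (htw : S.Holds t w)
    (hy : S.Holds y (Rel.triple hzt htw ≫ p)) (ht : R.Holds (Rel.triple hxy hyz ≫ p) t),
    Rel.triple hxy hy ≫ p = Rel.triple ht htw ≫ p

end Goursat

/-- A Goursat category: a regular category whose equivalence relations are 3-permutable, i.e.
`R S R = S R S` for any two equivalence relations `R`, `S` on the same object. -/
class IsGoursatCategory (C : Type u) [Category.{v} C] [Regular C] : Prop where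
  three_permutable : ∀ {X : C} (R S : Goursat.Rel X X), R.IsEquiv → S.IsEquiv →
    R.comp (S.comp R) = S.comp (R.comp S)

/-! The arrow `tripleMap` from `R ×_X S` to `f(R) ×_Y f(S)` is a regular epimorphism, and `p ≫ f` is
constant on its fibres, so `p ≫ f` descends to an arrow `q`, which is the connector sought.
Three-permutability enters in three places. Played against the kernel pair of `f`, it makes `f(R)`
and `f(S)` transitive. Applied on a pullback of split epimorphisms, it gives
`exists_cover_lift_pair`, hence surjectivity of `tripleMap`. Applied to kernel pairs, it gives
`shifting_lemma`, two uses of which yield `IsConnector.comp_congr`, the constancy on fibres. The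
axioms for `q` are checked on generalised elements after lifting them along a regular epimorphism.
Only associativity needs care: two triples must be lifted with a common point, again by
`exists_cover_lift_pair`. -/

namespace Goursat

/-! ### Generalised elements and regular epimorphic covers. -/

/-- Membership in a subobject is local. -/
theorem factors_of_cover {C : Type u} [Category.{v} C] {A T T' : C} (P : Subobject A)
    (e : T' ⟶ T) [IsRegularEpi e]
    (x : T ⟶ A) (h : P.Factors (e ≫ x)) : P.Factors x := by
  -- A regular epimorphism is strong, so it lifts against the monomorphism `P.arrow`.
  have sq : CommSq (P.factorThru _ h) e P.arrow x := ⟨by simp⟩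
  exact (Subobject.factors_iff _ _).2 ⟨sq.lift, sq.fac_right⟩

variable {C : Type u} [Category.{v} C] [Regular C]

theorem isRegularEpi_comp {A B D : C} (f : A ⟶ B) (g : B ⟶ D) [IsRegularEpi f]
    [IsRegularEpi g] : IsRegularEpi (f ≫ g) := by
  have : StrongEpi (f ≫ g) := strongEpi_comp f g
  infer_instance

/-- Generalised elements lift locally along a regular epimorphism. -/
theorem exists_cover_lift {A B T : C} (g : A ⟶ B) [IsRegularEpi g] (b : T ⟶ B) :
    ∃ (T' : C) (e : T' ⟶ T) (a : T' ⟶ A), IsRegularEpi e ∧ a ≫ g = e ≫ b :=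
  ⟨pullback g b, pullback.snd g b, pullback.fst g b, inferInstance, pullback.condition⟩

/-- An arrow `g` through which all generalised elements factor locally is a regular
epimorphism. -/
theorem isRegularEpi_of_cover_lift {A B T : C} (g : A ⟶ B) (e : T ⟶ B) (a : T ⟶ A)
    [IsRegularEpi e] (h : a ≫ g = e) : IsRegularEpi g := by
  have : StrongEpi (a ≫ g) := by rw [h]; infer_instance
  have : StrongEpi g := strongEpi_of_strongEpi a g
  infer_instance

theorem isRegularEpi_factorThruImageSubobject {A B : C} (g : A ⟶ B) :
    IsRegularEpi (factorThruImageSubobject g) := by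
  have := isRegularEpi_factorThruImage g
  exact isRegularEpi_comp _ _

theorem imageSubobject_factors_iff {A B T : C} (g : A ⟶ B) (b : T ⟶ B) :
    (imageSubobject g).Factors b ↔
      ∃ (T' : C) (e : T' ⟶ T) (a : T' ⟶ A), IsRegularEpi e ∧ a ≫ g = e ≫ b := by
  constructor
  · intro h
    have := isRegularEpi_factorThruImageSubobject g
    obtain ⟨T', e, a, he, ha⟩ := exists_cover_lift (factorThruImageSubobject g)
      ((imageSubobject g).factorThru b h)
    refine ⟨T', e, a, he, ?_⟩
    rw [← imageSubobject_arrow_comp g, reassoc_of% ha, Subobject.factorThru_arrow]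
  · rintro ⟨T', e, a, he, ha⟩
    apply factors_of_cover _ e
    rw [← ha]
    exact imageSubobject_factors_comp_self _ _

/-! ### Relations, composites and regular images on generalised elements. -/

namespace Rel

variable {X Y Z T T' : C}

theorem Holds.precomp {R : Rel X Y} {x : T ⟶ X} {y : T ⟶ Y} (h : R.Holds x y) (e : T' ⟶ T) :
    R.Holds (e ≫ x) (e ≫ y) := by
  rw [Holds, ← prod.comp_lift]
  exact Subobject.factors_of_factors_right _ h

theorem holds_of_cover {R : Rel X Y} (e : T' ⟶ T) [IsRegularEpi e] {x : T ⟶ X} {y : T ⟶ Y}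
    (h : R.Holds (e ≫ x) (e ≫ y)) : R.Holds x y := by
  rw [Holds, ← prod.comp_lift] at h
  exact factors_of_cover _ e _ h

theorem holds_legs (R : Rel X Y) (a : T ⟶ (R : C)) : R.Holds (a ≫ R.fst) (a ≫ R.snd) := by
  have : prod.lift (a ≫ R.fst) (a ≫ R.snd) = a ≫ R.arrow := by
    ext <;> simp [prod.lift_fst, prod.lift_snd]
  rw [Holds, this]
  exact Subobject.factors_comp_arrow _

theorem Holds.exists_legs {R : Rel X Y} {x : T ⟶ X} {y : T ⟶ Y} (h : R.Holds x y) :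
    ∃ a : T ⟶ (R : C), a ≫ R.fst = x ∧ a ≫ R.snd = y :=
  ⟨R.factorThru _ h, by simp [prod.lift_fst], by simp [prod.lift_snd]⟩

theorem hom_ext_legs (R : Rel X Y) {a b : T ⟶ (R : C)} (h₁ : a ≫ R.fst = b ≫ R.fst)
    (h₂ : a ≫ R.snd = b ≫ R.snd) : a = b := by
  rw [← cancel_mono R.arrow]
  ext <;> simpa

theorem holds_comp_iff (S : Rel Y Z) (R : Rel X Y) (x : T ⟶ X) (z : T ⟶ Z) :
    (S.comp R).Holds x z ↔ ∃ (T' : C) (e : T' ⟶ T) (y : T' ⟶ Y), IsRegularEpi e ∧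
      R.Holds (e ≫ x) y ∧ S.Holds y (e ≫ z) := by
  rw [Holds, comp, imageSubobject_factors_iff]
  constructor
  · rintro ⟨T', e, a, he, ha⟩
    have h₁ := congr($ha ≫ prod.fst)
    have h₂ := congr($ha ≫ prod.snd)
    simp only [Category.assoc, prod.lift_fst, prod.lift_snd] at h₁ h₂
    refine ⟨T', e, a ≫ pullback.fst _ _ ≫ R.snd, he, ?_, ?_⟩
    · simpa [← h₁] using R.holds_legs (a ≫ pullback.fst _ _)
    · rw [pullback.condition]
      simpa [← h₂] using S.holds_legs (a ≫ pullback.snd _ _)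
  · rintro ⟨T', e, y, he, h₁, h₂⟩
    obtain ⟨a, ha₁, ha₂⟩ := h₁.exists_legs
    obtain ⟨b, hb₁, hb₂⟩ := h₂.exists_legs
    refine ⟨T', e, pullback.lift a b (ha₂.trans hb₁.symm), he, ?_⟩
    ext
    · rw [Category.assoc, Category.assoc, prod.lift_fst, prod.lift_fst,
        pullback.lift_fst_assoc, ha₁]
    · rw [Category.assoc, Category.assoc, prod.lift_snd, prod.lift_snd,
        pullback.lift_snd_assoc, hb₂]

theorem holds_regularImage_iff (f : X ⟶ Y) (R : Rel X X) (y z : T ⟶ Y) :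
    (R.regularImage f).Holds y z ↔ ∃ (T' : C) (e : T' ⟶ T) (a b : T' ⟶ X), IsRegularEpi e ∧
      R.Holds a b ∧ a ≫ f = e ≫ y ∧ b ≫ f = e ≫ z := by
  rw [Holds, regularImage, imageSubobject_factors_iff]
  constructor
  · rintro ⟨T', e, a, he, ha⟩
    have h₁ := congr($ha ≫ prod.fst)
    have h₂ := congr($ha ≫ prod.snd)
    simp only [Category.assoc, prod.lift_fst, prod.lift_snd, prod.map_fst, prod.map_snd] at h₁ h₂
    exact ⟨T', e, a ≫ R.fst, a ≫ R.snd, he, R.holds_legs a, by simpa using h₁, by simpa using h₂⟩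
  · rintro ⟨T', e, a, b, he, h, h₁, h₂⟩
    obtain ⟨c, rfl, rfl⟩ := h.exists_legs
    refine ⟨T', e, c, he, ?_⟩
    ext
    · simpa [prod.lift_fst] using h₁
    · simpa [prod.lift_snd] using h₂

theorem Holds.regularImage {R : Rel X X} {a b : T ⟶ X} (h : R.Holds a b) (f : X ⟶ Y) :
    (R.regularImage f).Holds (a ≫ f) (b ≫ f) :=
  (holds_regularImage_iff f R _ _).2 ⟨T, 𝟙 T, a, b, inferInstance, h, by simp, by simp⟩

/-- A relation is an equivalence relation when it is one on generalised elements. -/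
theorem IsEquiv.of_holds {R : Rel X X} (refl : R.Holds (𝟙 X) (𝟙 X))
    (symm : ∀ {T : C} {x y : T ⟶ X}, R.Holds x y → R.Holds y x)
    (trans : ∀ {T : C} {x y z : T ⟶ X}, R.Holds x y → R.Holds y z → R.Holds x z) :
    R.IsEquiv := by
  obtain ⟨r, hr₁, hr₂⟩ := refl.exists_legs
  obtain ⟨s, hs₁, hs₂⟩ := (symm (R.holds_legs (𝟙 _))).exists_legs
  have hyz := R.holds_legs (pullback.snd R.snd R.fst)
  rw [← pullback.condition] at hyz
  obtain ⟨t, ht₁, ht₂⟩ := (trans (R.holds_legs (pullback.fst R.snd R.fst)) hyz).exists_legs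
  exact ⟨⟨{
    right_cancellation := fun _ _ _ h₁ h₂ => R.hom_ext_legs h₁ h₂
    r := r
    reflexivity₁ := hr₁
    reflexivity₂ := hr₂
    s := s
    symmetry₁ := by simpa using hs₁
    symmetry₂ := by simpa using hs₂
    c := _
    isLimit := pullbackIsPullback R.snd R.fst
    t := t
    transitivity₁ := ht₁
    transitivity₂ := ht₂ }⟩⟩

theorem IsEquiv.refl {R : Rel X X} (hR : R.IsEquiv) (x : T ⟶ X) : R.Holds x x := by
  obtain ⟨⟨E⟩⟩ := hR
  have h := R.holds_legs (x ≫ E.r)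
  rwa [Category.assoc, Category.assoc, E.reflexivity₁, E.reflexivity₂, Category.comp_id] at h

theorem IsEquiv.symm {R : Rel X X} (hR : R.IsEquiv) {x y : T ⟶ X} (h : R.Holds x y) :
    R.Holds y x := by
  obtain ⟨⟨E⟩⟩ := hR
  obtain ⟨a, rfl, rfl⟩ := h.exists_legs
  have h := R.holds_legs (a ≫ E.s)
  rwa [Category.assoc, Category.assoc, E.symmetry₁, E.symmetry₂] at h

theorem IsEquiv.trans {R : Rel X X} (hR : R.IsEquiv) {x y z : T ⟶ X} (h : R.Holds x y)
    (h' : R.Holds y z) : R.Holds x z := by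
  obtain ⟨⟨E⟩⟩ := hR
  obtain ⟨a, rfl, rfl⟩ := h.exists_legs
  obtain ⟨b, hb, rfl⟩ := h'.exists_legs
  obtain ⟨c, hc₁, hc₂⟩ := PullbackCone.IsLimit.lift' E.isLimit a b hb.symm
  have h := R.holds_legs (c ≫ E.t)
  rwa [Category.assoc, Category.assoc, E.transitivity₁, E.transitivity₂, reassoc_of% hc₁,
    reassoc_of% hc₂] at h

/-- The kernel pair of an arrow, as a relation. -/
noncomputable def ker (g : X ⟶ Y) : Rel X X :=
  equalizerSubobject (prod.fst ≫ g) (prod.snd ≫ g)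

@[simp]
theorem holds_ker_iff (g : X ⟶ Y) (x y : T ⟶ X) : (ker g).Holds x y ↔ x ≫ g = y ≫ g := by
  rw [Holds, ker, equalizerSubobject_factors_iff, prod.lift_fst_assoc, prod.lift_snd_assoc]

theorem isEquiv_ker (g : X ⟶ Y) : (ker g).IsEquiv :=
  .of_holds (by simp) (by simp +contextual) (by simp +contextual)

end Rel

/-! ### Triples as generalised elements of `R ×_X S`. -/

section

variable {C : Type u} [Category.{v} C] [Regular C]

theorem comp_prodLift_eq_iff {P A B T : C} {u v : T ⟶ P} {a : P ⟶ A} {b : P ⟶ B} :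
    u ≫ prod.lift a b = v ≫ prod.lift a b ↔ u ≫ a = v ≫ a ∧ u ≫ b = v ≫ b := by
  rw [prod.comp_lift, prod.comp_lift]
  refine ⟨fun h => ⟨?_, ?_⟩, fun h => by rw [h.1, h.2]⟩
  · simpa only [prod.lift_fst] using congr($h ≫ prod.fst)
  · simpa only [prod.lift_snd] using congr($h ≫ prod.snd)

namespace Rel

/-- Presents an intersection of two kernel pairs as a single kernel pair, so that
three-permutability applies to it. -/
theorem holds_ker_prodLift_iff {P A B T : C} {u v : T ⟶ P} {a : P ⟶ A} {b : P ⟶ B} :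
    (ker (prod.lift a b)).Holds u v ↔ u ≫ a = v ≫ a ∧ u ≫ b = v ≫ b := by
  rw [holds_ker_iff, comp_prodLift_eq_iff]

variable {X T T' : C} (R S : Rel X X)

/-- The first component `x` of `(x, y, z)` in `R ×_X S`. -/
noncomputable def pt₁ : pullback R.snd S.fst ⟶ X := pullback.fst _ _ ≫ R.fst

/-- The second component `y` of `(x, y, z)` in `R ×_X S`. -/
noncomputable def pt₂ : pullback R.snd S.fst ⟶ X := pullback.fst _ _ ≫ R.snd

/-- The third component `z` of `(x, y, z)` in `R ×_X S`. -/
noncomputable def pt₃ : pullback R.snd S.fst ⟶ X := pullback.snd _ _ ≫ S.snd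

variable {R S}

theorem holds_pt₁_pt₂ (a : T ⟶ pullback R.snd S.fst) :
    R.Holds (a ≫ pt₁ R S) (a ≫ pt₂ R S) := by
  simpa only [pt₁, pt₂, Category.assoc] using R.holds_legs (a ≫ pullback.fst _ _)

theorem holds_pt₂_pt₃ (a : T ⟶ pullback R.snd S.fst) :
    S.Holds (a ≫ pt₂ R S) (a ≫ pt₃ R S) := by
  rw [pt₂, pullback.condition]
  simpa only [pt₃, Category.assoc] using S.holds_legs (a ≫ pullback.snd _ _)

theorem triple_hom_ext {a b : T ⟶ pullback R.snd S.fst} (h₁ : a ≫ pt₁ R S = b ≫ pt₁ R S)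
    (h₂ : a ≫ pt₂ R S = b ≫ pt₂ R S) (h₃ : a ≫ pt₃ R S = b ≫ pt₃ R S) : a = b := by
  have h₂' := h₂
  rw [pt₂, pullback.condition] at h₂'
  rw [pt₁] at h₁
  rw [pt₂] at h₂
  rw [pt₃] at h₃
  apply pullback.hom_ext
  · apply R.hom_ext_legs <;> simpa only [Category.assoc]
  · apply S.hom_ext_legs <;> simpa only [Category.assoc]

section

variable {x y z : T ⟶ X} (hxy : R.Holds x y) (hyz : S.Holds y z)

@[simp]
theorem triple_pt₁ : triple hxy hyz ≫ pt₁ R S = x := by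
  rw [triple, pt₁, pullback.lift_fst_assoc, Subobject.factorThru_arrow_assoc, prod.lift_fst]

@[simp]
theorem triple_pt₂ : triple hxy hyz ≫ pt₂ R S = y := by
  rw [triple, pt₂, pullback.lift_fst_assoc, Subobject.factorThru_arrow_assoc, prod.lift_snd]

@[simp]
theorem triple_pt₃ : triple hxy hyz ≫ pt₃ R S = z := by
  rw [triple, pt₃, pullback.lift_snd_assoc, Subobject.factorThru_arrow_assoc, prod.lift_snd]

end

theorem triple_eta (a : T ⟶ pullback R.snd S.fst) :
    triple (holds_pt₁_pt₂ a) (holds_pt₂_pt₃ a) = a :=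
  triple_hom_ext (by simp) (by simp) (by simp)

theorem comp_triple {x y z : T ⟶ X} (hxy : R.Holds x y) (hyz : S.Holds y z) (e : T' ⟶ T) :
    e ≫ triple hxy hyz = triple (hxy.precomp e) (hyz.precomp e) :=
  triple_hom_ext (by simp) (by simp) (by simp)

end Rel

end

/-! ### Consequences of three-permutability. -/

variable {C : Type u} [Category.{v} C] [Regular C] [IsGoursatCategory C]

/-- Three-permutability on generalised elements: if `a R b S c R d` then locally there are
`u` and `v` with `a S u R v S d`. -/
theorem Rel.IsEquiv.three_permutable {X T : C} {R S : Rel X X} (hR : R.IsEquiv)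
    (hS : S.IsEquiv) {a b c d : T ⟶ X} (hab : R.Holds a b) (hbc : S.Holds b c)
    (hcd : R.Holds c d) :
    ∃ (T' : C) (e : T' ⟶ T) (u v : T' ⟶ X), IsRegularEpi e ∧
      S.Holds (e ≫ a) u ∧ R.Holds u v ∧ S.Holds v (e ≫ d) := by
  have h : (R.comp (S.comp R)).Holds a d :=
    (Rel.holds_comp_iff _ _ _ _).2 ⟨T, 𝟙 T, c, inferInstance,
      (Rel.holds_comp_iff _ _ _ _).2 ⟨T, 𝟙 T, b, inferInstance, by simpa, by simpa⟩, by simpa⟩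
  rw [IsGoursatCategory.three_permutable R S hR hS, Rel.holds_comp_iff] at h
  obtain ⟨T₁, e₁, v, he₁, hv, hvd⟩ := h
  obtain ⟨T₂, e₂, u, he₂, hau, huv⟩ := (Rel.holds_comp_iff _ _ _ _).1 hv
  exact ⟨T₂, e₂ ≫ e₁, u, e₂ ≫ v, isRegularEpi_comp _ _, by simpa using hau, huv,
    by simpa using hvd.precomp e₂⟩

/-- The Shifting Lemma for kernel pairs. -/
theorem shifting_lemma {P A B D T : C} (r : P ⟶ A) (s : P ⟶ B) (t : P ⟶ D)
    (h : ∀ {T : C} (x y : T ⟶ P), x ≫ r = y ≫ r → x ≫ s = y ≫ s → x ≫ t = y ≫ t)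
    {x y z w : T ⟶ P} (hxy : x ≫ r = y ≫ r) (hs : y ≫ s = z ≫ s) (ht : y ≫ t = z ≫ t)
    (hzw : z ≫ r = w ≫ r) (hxw : x ≫ s = w ≫ s) : x ≫ t = w ≫ t := by
  -- Permuting `ker r` with `ker s ∩ ker t` puts `u` and `v` between `x` and `w`. Through `x` and
  -- `w` they agree under `s`, and they agree under `r`, so `h` makes them agree under `t`.
  obtain ⟨T', e, u, v, he, hxu, huv, hvw⟩ :=
    (Rel.isEquiv_ker r).three_permutable (Rel.isEquiv_ker (prod.lift s t))
      (a := x) (b := y) (c := z) (d := w) (by simpa) (Rel.holds_ker_prodLift_iff.2 ⟨hs, ht⟩)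
      (by simpa)
  rw [Rel.holds_ker_prodLift_iff, Category.assoc, Category.assoc] at hxu hvw
  rw [Rel.holds_ker_iff] at huv
  have huv' : u ≫ t = v ≫ t := h u v huv (by rw [← hxu.1, hvw.1, hxw])
  rw [← cancel_epi e, hxu.2, huv', hvw.2]

/-- In a Goursat category, pullbacks of split epimorphisms are compatible with regular images:
given regular epimorphisms `α`, `β` over `f` from the split epimorphisms `F`, `G` to `F'`, `G'`,
all generalised elements of the pullback of `F'` and `G'` lift locally to that of `F` and `G`. -/
theorem exists_cover_lift_pair {A B X A' B' X' T : C} {F : A ⟶ X} {G : B ⟶ X} {s : X ⟶ A}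
    {t : X ⟶ B} (hs : s ≫ F = 𝟙 X) (ht : t ≫ G = 𝟙 X) {F' : A' ⟶ X'} {G' : B' ⟶ X'}
    {s' : X' ⟶ A'} {t' : X' ⟶ B'} {f : X ⟶ X'} (α : A ⟶ A') (β : B ⟶ B') [IsRegularEpi α]
    [IsRegularEpi β] (hF : α ≫ F' = F ≫ f) (hG : β ≫ G' = G ≫ f) (hα : s ≫ α = f ≫ s')
    (hβ : t ≫ β = f ≫ t') {a' : T ⟶ A'} {b' : T ⟶ B'} (h : a' ≫ F' = b' ≫ G') :
    ∃ (T' : C) (e : T' ⟶ T) (a : T' ⟶ A) (b : T' ⟶ B), IsRegularEpi e ∧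
      a ≫ α = e ≫ a' ∧ b ≫ β = e ≫ b' ∧ a ≫ F = b ≫ G := by
  obtain ⟨T₁, e₁, a, he₁, ha⟩ := exists_cover_lift α a'
  obtain ⟨T₂, e₂, b, he₂, hb⟩ := exists_cover_lift β (e₁ ≫ b')
  -- The independent lifts `a` and `b` may lie over different points `x`, `y` of `X`, equal only
  -- after `f`.
  let x := e₂ ≫ a ≫ F
  let y := b ≫ G
  have hxy : x ≫ f = y ≫ f := by
    simp only [x, y, Category.assoc, ← hF, ← hG, reassoc_of% ha, reassoc_of% hb, h]
  have hsα : (x ≫ s) ≫ α = (y ≫ s) ≫ α := by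
    simp only [Category.assoc, hα, reassoc_of% hxy]
  have htβ : (x ≫ t) ≫ β = (y ≫ t) ≫ β := by
    simp only [Category.assoc, hβ, reassoc_of% hxy]
  -- The chain is `(a, t x)`, `(s x, t x)`, `(s y, t y)`, `(s y, b)`: outer links keep the base
  -- point, the middle one keeps the image under `α` and `β`. After permuting, `u` has the `α`-image
  -- of `a`, `v` has the `β`-image of `b`, and both lie over one point.
  obtain ⟨T₃, e₃, u, v, he₃, hu, huv, hv⟩ :=
    (Rel.isEquiv_ker (pullback.fst F G ≫ F)).three_permutable
      (Rel.isEquiv_ker (prod.lift (pullback.fst F G ≫ α) (pullback.snd F G ≫ β)))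
      (a := pullback.lift (e₂ ≫ a) (x ≫ t) (by simp [x, ht]))
      (b := pullback.lift (x ≫ s) (x ≫ t) (by simp [hs, ht]))
      (c := pullback.lift (y ≫ s) (y ≫ t) (by simp [hs, ht]))
      (d := pullback.lift (y ≫ s) b (by simp [y, hs]))
      (by simp [pullback.lift_fst_assoc, x, hs])
      (by
        simp only [Rel.holds_ker_prodLift_iff, pullback.lift_fst_assoc,
          pullback.lift_snd_assoc]
        exact ⟨hsα, htβ⟩)
      (by simp [pullback.lift_fst_assoc])
  rw [Rel.holds_ker_prodLift_iff] at hu hv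
  rw [Rel.holds_ker_iff] at huv
  simp only [Category.assoc, pullback.lift_fst_assoc, pullback.lift_snd_assoc] at hu huv hv
  have : IsRegularEpi (e₂ ≫ e₁) := isRegularEpi_comp _ _
  refine ⟨T₃, e₃ ≫ e₂ ≫ e₁, u ≫ pullback.fst F G, v ≫ pullback.snd F G,
    isRegularEpi_comp _ _, ?_, ?_, ?_⟩
  · simp only [Category.assoc, ← hu.1, ha]
  · simp only [Category.assoc, hv.2, hb]
  · rw [Category.assoc, huv, pullback.condition, Category.assoc]

/-- In a Goursat category, regular images of equivalence relations are equivalence relations. -/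
theorem Rel.IsEquiv.regularImage {X Y : C} {R : Rel X X} (hR : R.IsEquiv) (f : X ⟶ Y)
    [IsRegularEpi f] : (R.regularImage f).IsEquiv := by
  refine .of_holds ?_ ?_ ?_
  · apply Rel.holds_of_cover f
    simpa using (hR.refl (𝟙 X)).regularImage f
  · intro T x y h
    obtain ⟨T', e, a, b, he, hab, ha, hb⟩ := (Rel.holds_regularImage_iff _ _ _ _).1 h
    exact (Rel.holds_regularImage_iff _ _ _ _).2 ⟨T', e, b, a, he, hR.symm hab, hb, ha⟩
  · intro T x y z hxy hyz
    obtain ⟨T₁, e₁, a, b, he₁, hab, ha, hb⟩ := (Rel.holds_regularImage_iff _ _ _ _).1 hxy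
    obtain ⟨T₂, e₂, c, d, he₂, hcd, hc, hd⟩ :=
      (Rel.holds_regularImage_iff _ _ _ _).1 (hyz.precomp e₁)
    -- The chain `a R b`, `b ~ c`, `c R d`, with `~` the kernel pair of `f`, becomes `a ~ u`, `u R
    -- v`, `v ~ d`.
    obtain ⟨T₃, e₃, u, v, he₃, hu, huv, hv⟩ :=
      hR.three_permutable (Rel.isEquiv_ker f) (hab.precomp e₂) (by simp [hb, hc]) hcd
    simp only [Rel.holds_ker_iff, Category.assoc, ha, hd] at hu hv
    have : IsRegularEpi (e₂ ≫ e₁) := isRegularEpi_comp _ _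
    exact (Rel.holds_regularImage_iff _ _ _ _).2 ⟨T₃, e₃ ≫ e₂ ≫ e₁, u, v,
      isRegularEpi_comp _ _, huv, by simp [hu], by simp [hv]⟩

/-! ### The comparison `R ×_X S ⟶ f(R) ×_Y f(S)`. -/

open Goursat.Rel

section

variable {C : Type u} [Category.{v} C] [Regular C]

namespace Rel

variable {X Y T : C} {R S : Rel X X}

/-- The regular epimorphism from a relation to its regular image. -/
theorem exists_regularEpi_regularImage (f : X ⟶ Y) (R : Rel X X) :
    ∃ α : (R : C) ⟶ (R.regularImage f : C), IsRegularEpi α ∧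
      α ≫ (R.regularImage f).fst = R.fst ≫ f ∧ α ≫ (R.regularImage f).snd = R.snd ≫ f := by
  obtain ⟨α, hα, h⟩ : ∃ α : (R : C) ⟶ (R.regularImage f : C), IsRegularEpi α ∧
      α ≫ (R.regularImage f).arrow = R.arrow ≫ prod.map f f :=
    ⟨_, isRegularEpi_factorThruImageSubobject _, imageSubobject_arrow_comp _⟩
  refine ⟨α, hα, ?_, ?_⟩
  · rw [reassoc_of% h, prod.map_fst, Category.assoc]
  · rw [reassoc_of% h, prod.map_snd, Category.assoc]

/-- An arrow from a relation to its regular image commutes with the diagonals. -/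
theorem IsEquiv.exists_diag_comp_eq {f : X ⟶ Y} (hR : R.IsEquiv)
    (hfR : (R.regularImage f).IsEquiv) {α : (R : C) ⟶ (R.regularImage f : C)}
    (h₁ : α ≫ (R.regularImage f).fst = R.fst ≫ f)
    (h₂ : α ≫ (R.regularImage f).snd = R.snd ≫ f) :
    ∃ (s : X ⟶ (R : C)) (s' : Y ⟶ (R.regularImage f : C)),
      s ≫ R.fst = 𝟙 X ∧ s ≫ R.snd = 𝟙 X ∧ s ≫ α = f ≫ s' := by
  obtain ⟨s, hs₁, hs₂⟩ := (hR.refl (𝟙 X)).exists_legs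
  obtain ⟨s', hs'₁, hs'₂⟩ := (hfR.refl (𝟙 Y)).exists_legs
  refine ⟨s, s', hs₁, hs₂, ?_⟩
  apply hom_ext_legs <;> rw [Category.assoc, Category.assoc]
  · rw [h₁, hs'₁, ← Category.assoc, hs₁, Category.id_comp, Category.comp_id]
  · rw [h₂, hs'₂, ← Category.assoc, hs₂, Category.id_comp, Category.comp_id]

/-- The arrow `R ×_X S ⟶ f(R) ×_Y f(S)` induced by `f`. -/
noncomputable def tripleMap (f : X ⟶ Y) (R S : Rel X X) :
    pullback R.snd S.fst ⟶ pullback (R.regularImage f).snd (S.regularImage f).fst :=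
  triple ((holds_pt₁_pt₂ (𝟙 _)).regularImage f) ((holds_pt₂_pt₃ (𝟙 _)).regularImage f)

@[simp]
theorem tripleMap_pt₁ (f : X ⟶ Y) (R S : Rel X X) :
    tripleMap f R S ≫ pt₁ _ _ = pt₁ R S ≫ f := by simp [tripleMap]

@[simp]
theorem tripleMap_pt₂ (f : X ⟶ Y) (R S : Rel X X) :
    tripleMap f R S ≫ pt₂ _ _ = pt₂ R S ≫ f := by simp [tripleMap]

@[simp]
theorem tripleMap_pt₃ (f : X ⟶ Y) (R S : Rel X X) :
    tripleMap f R S ≫ pt₃ _ _ = pt₃ R S ≫ f := by simp [tripleMap]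

end Rel

namespace IsConnector

variable {X T T' : C} {R S : Rel X X} {p : pullback R.snd S.fst ⟶ X}

/-- Frees the axiom from the proofs carried by `triple`, so that it applies to any arrow into the
pullback. -/
theorem comp_eq_pt₃ (hp : IsConnector R S p) (a : T ⟶ pullback R.snd S.fst)
    (h : a ≫ pt₁ R S = a ≫ pt₂ R S) : a ≫ p = a ≫ pt₃ R S := by
  have hR := holds_pt₁_pt₂ a
  have hS := holds_pt₂_pt₃ a
  rw [← h] at hR hS
  rw [← hp.map_left _ _ hR hS]
  congr 1
  exact triple_hom_ext (by simp) (by simp [h]) (by simp)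

theorem comp_eq_pt₁ (hp : IsConnector R S p) (a : T ⟶ pullback R.snd S.fst)
    (h : a ≫ pt₂ R S = a ≫ pt₃ R S) : a ≫ p = a ≫ pt₁ R S := by
  have hR := holds_pt₁_pt₂ a
  have hS := holds_pt₂_pt₃ a
  rw [← h] at hS
  rw [← hp.map_right _ _ hR hS]
  congr 1
  exact triple_hom_ext (by simp) (by simp) (by simp [h])

end IsConnector

end

/-! ### Descent of the connector along `tripleMap`. -/

variable {C : Type u} [Category.{v} C] [Regular C] [IsGoursatCategory C]

/-- A connector is compatible with the kernel pair of any arrow: if `x`, `y`, `z` and `x'`, `y'`,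
`z'` have the same images, then so do `p(x, y, z)` and `p(x', y', z')`. -/
theorem IsConnector.comp_congr {X Y : C} {R S : Rel X X} (hR : R.IsEquiv) (hS : S.IsEquiv)
    {p : pullback R.snd S.fst ⟶ X} (hp : IsConnector R S p) (f : X ⟶ Y) {T : C}
    {a b : T ⟶ pullback R.snd S.fst} (h₁ : a ≫ pt₁ R S ≫ f = b ≫ pt₁ R S ≫ f)
    (h₂ : a ≫ pt₂ R S ≫ f = b ≫ pt₂ R S ≫ f) (h₃ : a ≫ pt₃ R S ≫ f = b ≫ pt₃ R S ≫ f) :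
    a ≫ p ≫ f = b ≫ p ≫ f := by
  -- First only the third coordinate varies. The far side of the rectangle consists of the triples
  -- `(y, y, z)`, where `p` returns `z`.
  have key {T : C} (a b : T ⟶ pullback R.snd S.fst) (h₁ : a ≫ pt₁ R S = b ≫ pt₁ R S)
      (h₂ : a ≫ pt₂ R S = b ≫ pt₂ R S) (h₃ : a ≫ pt₃ R S ≫ f = b ≫ pt₃ R S ≫ f) :
      a ≫ p ≫ f = b ≫ p ≫ f := by
    let l {T : C} (a : T ⟶ pullback R.snd S.fst) : T ⟶ pullback R.snd S.fst :=
      triple (hR.refl (a ≫ pt₂ R S)) (holds_pt₂_pt₃ a)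
    have hl {T : C} (a : T ⟶ pullback R.snd S.fst) : l a ≫ p = a ≫ pt₃ R S := by
      rw [hp.comp_eq_pt₃ _ (by simp [l])]
      simp [l]
    refine shifting_lemma (prod.lift (pt₂ R S) (pt₃ R S))
      (prod.lift (prod.lift (pt₁ R S) (pt₂ R S)) (pt₃ R S ≫ f)) (p ≫ f) ?_
      (y := l a) (z := l b) ?_ ?_ ?_ ?_ ?_
    · simp only [comp_prodLift_eq_iff]
      rintro T x y ⟨h₂, h₃⟩ ⟨⟨h₁, -⟩, -⟩
      rw [triple_hom_ext h₁ h₂ h₃]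
    · simp [comp_prodLift_eq_iff, l, -prod.comp_lift]
    · simp [comp_prodLift_eq_iff, l, h₂, reassoc_of% triple_pt₃, h₃, -prod.comp_lift]
    · rw [reassoc_of% hl, reassoc_of% hl, h₃]
    · simp [comp_prodLift_eq_iff, l, -prod.comp_lift]
    · simp [comp_prodLift_eq_iff, h₁, h₂, h₃, -prod.comp_lift]
  -- In general the far side consists of the triples `(x, y, y)`, where `p` returns `x`; `key`
  -- supplies the inclusion that the Shifting Lemma requires.
  let l {T : C} (a : T ⟶ pullback R.snd S.fst) : T ⟶ pullback R.snd S.fst :=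
    triple (holds_pt₁_pt₂ a) (hS.refl (a ≫ pt₂ R S))
  have hl {T : C} (a : T ⟶ pullback R.snd S.fst) : l a ≫ p = a ≫ pt₁ R S := by
    rw [hp.comp_eq_pt₁ _ (by simp [l])]
    simp [l]
  refine shifting_lemma (prod.lift (pt₁ R S) (pt₂ R S)) (tripleMap f R S) (p ≫ f) ?_
    (y := l a) (z := l b) ?_ ?_ ?_ ?_ ?_
  · simp only [comp_prodLift_eq_iff]
    rintro T x y ⟨h₁, h₂⟩ h
    refine key x y h₁ h₂ ?_
    simpa using congr($h ≫ pt₃ _ _)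
  · simp [comp_prodLift_eq_iff, l, -prod.comp_lift]
  · apply triple_hom_ext <;>
      simp [l, reassoc_of% triple_pt₁, reassoc_of% triple_pt₂, reassoc_of% triple_pt₃, h₁, h₂]
  · rw [reassoc_of% hl, reassoc_of% hl, h₁]
  · simp [comp_prodLift_eq_iff, l, -prod.comp_lift]
  · apply triple_hom_ext <;> simp [h₁, h₂, h₃]

/-- Reflexivity splits the legs being pulled back, compatibly with `R ⟶ f(R)` and `S ⟶ f(S)`, so the
universal pair of `f(R) ×_Y f(S)` lifts locally. -/
theorem isRegularEpi_tripleMap {X Y : C} (f : X ⟶ Y) [IsRegularEpi f] {R S : Rel X X}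
    (hR : R.IsEquiv) (hS : S.IsEquiv) : IsRegularEpi (tripleMap f R S) := by
  obtain ⟨α, _, hα₁, hα₂⟩ := exists_regularEpi_regularImage f R
  obtain ⟨β, _, hβ₁, hβ₂⟩ := exists_regularEpi_regularImage f S
  obtain ⟨s, s', -, hs, hsα⟩ := hR.exists_diag_comp_eq (hR.regularImage f) hα₁ hα₂
  obtain ⟨t, t', ht, -, htβ⟩ := hS.exists_diag_comp_eq (hS.regularImage f) hβ₁ hβ₂
  obtain ⟨T, e, a, b, he, ha, hb, hab⟩ := exists_cover_lift_pair hs ht α β hα₂ hβ₁ hsα htβ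
    (pullback.condition (f := (R.regularImage f).snd) (g := (S.regularImage f).fst))
  apply isRegularEpi_of_cover_lift _ e (pullback.lift a b hab)
  apply triple_hom_ext
  · rw [Category.assoc, tripleMap_pt₁, pt₁, pt₁, Category.assoc, ← hα₁, pullback.lift_fst_assoc,
      reassoc_of% ha]
  · rw [Category.assoc, tripleMap_pt₂, pt₂, pt₂, Category.assoc, ← hα₂, pullback.lift_fst_assoc,
      reassoc_of% ha]
  · rw [Category.assoc, tripleMap_pt₃, pt₃, pt₃, Category.assoc, ← hβ₂, pullback.lift_snd_assoc,
      reassoc_of% hb]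

/-- Regular images of connectors: the descended arrow is a connector. -/
theorem IsConnector.of_tripleMap_comp {X Y : C} (f : X ⟶ Y) [IsRegularEpi f] {R S : Rel X X}
    (hR : R.IsEquiv) (hS : S.IsEquiv) {p : pullback R.snd S.fst ⟶ X} (hp : IsConnector R S p)
    {q : pullback (R.regularImage f).snd (S.regularImage f).fst ⟶ Y}
    (hq : tripleMap f R S ≫ q = p ≫ f) :
    IsConnector (R.regularImage f) (S.regularImage f) q := by
  have := isRegularEpi_tripleMap f hR hS
  have hp₁ {T : C} (a : T ⟶ pullback R.snd S.fst) : S.Holds (a ≫ pt₁ R S) (a ≫ p) := by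
    simpa only [triple_eta] using hp.rel_left _ _ _ (holds_pt₁_pt₂ a) (holds_pt₂_pt₃ a)
  have hp₃ {T : C} (a : T ⟶ pullback R.snd S.fst) : R.Holds (a ≫ p) (a ≫ pt₃ R S) := by
    simpa only [triple_eta] using hp.rel_right _ _ _ (holds_pt₁_pt₂ a) (holds_pt₂_pt₃ a)
  have htr {T : C} {x y z : T ⟶ X} (hxy : R.Holds x y) (hyz : S.Holds y z) :
      triple (hxy.regularImage f) (hyz.regularImage f) ≫ q = (triple hxy hyz ≫ p) ≫ f := by
    rw [Category.assoc, ← hq, ← Category.assoc]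
    congr 1
    apply triple_hom_ext <;>
      simp [reassoc_of% triple_pt₁, reassoc_of% triple_pt₂, reassoc_of% triple_pt₃]
  have hq₁ : (S.regularImage f).Holds (pt₁ _ _) q := by
    apply holds_of_cover (tripleMap f R S)
    simpa [hq] using (hp₁ (𝟙 _)).regularImage f
  have hq₃ : (R.regularImage f).Holds q (pt₃ _ _) := by
    apply holds_of_cover (tripleMap f R S)
    simpa [hq] using (hp₃ (𝟙 _)).regularImage f
  refine ⟨?_, ?_, ?_, ?_, ?_⟩
  · intro T x y z hxy hyz
    simpa using hq₁.precomp (triple hxy hyz)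
  · intro T x y z hxy hyz
    simpa using hq₃.precomp (triple hxy hyz)
  · intro T x y hxx hxy
    obtain ⟨T', e, a, b, he, hab, ha, hb⟩ := (holds_regularImage_iff _ _ _ _).1 hxy
    rw [← cancel_epi e, ← hb, ← hp.map_left a b (hR.refl a) hab, ← htr, ← Category.assoc,
      comp_triple]
    congr 1
    exact triple_hom_ext (by simp [ha]) (by simp [ha]) (by simp [hb])
  · intro T x y hxy hyy
    obtain ⟨T', e, a, b, he, hab, ha, hb⟩ := (holds_regularImage_iff _ _ _ _).1 hxy
    rw [← cancel_epi e, ← ha, ← hp.map_right a b hab (hS.refl b), ← htr, ← Category.assoc,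
      comp_triple]
    congr 1
    exact triple_hom_ext (by simp [ha]) (by simp [hb]) (by simp [hb])
  · intro T x y z t w hxy hyz hzt htw hy ht
    let d := triple (hR.refl (𝟙 X)) (hS.refl (𝟙 X))
    let d' := triple ((hR.regularImage f).refl (𝟙 Y)) ((hS.regularImage f).refl (𝟙 Y))
    have hd : d ≫ tripleMap f R S = f ≫ d' := by
      apply triple_hom_ext <;> simp [d, d', reassoc_of% triple_pt₁, reassoc_of% triple_pt₂,
        reassoc_of% triple_pt₃]
    -- Both lifted triples must share the point over `z`; the diagonal `d` splits both `pt₃` and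
    -- `pt₁`, as the lifting requires.
    obtain ⟨T', e, a, b, he, ha, hb, hab⟩ := exists_cover_lift_pair
      (F := pt₃ R S) (G := pt₁ R S) (s := d) (t := d) (by simp [d]) (by simp [d])
      (tripleMap f R S) (tripleMap f R S) (tripleMap_pt₃ f R S) (tripleMap_pt₁ f R S) hd hd
      (a' := triple hxy hyz) (b' := triple hzt htw) (by simp)
    have ha₁ := congr($ha ≫ pt₁ _ _)
    have ha₂ := congr($ha ≫ pt₂ _ _)
    have hb₂ := congr($hb ≫ pt₂ _ _)
    have hb₃ := congr($hb ≫ pt₃ _ _)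
    have haq := congr($ha ≫ q)
    have hbq := congr($hb ≫ q)
    simp only [Category.assoc, tripleMap_pt₁, tripleMap_pt₂, tripleMap_pt₃, triple_pt₁,
      triple_pt₂, triple_pt₃, hq] at ha₁ ha₂ hb₂ hb₃ haq hbq
    have hxy' := holds_pt₁_pt₂ a
    have hyz' := holds_pt₂_pt₃ a
    have hzt' := holds_pt₁_pt₂ b
    have htw' := holds_pt₂_pt₃ b
    rw [← hab] at hzt'
    have hb_eq : triple hzt' htw' = b := triple_hom_ext (by simp [hab]) (by simp) (by simp)
    have hy' := hS.trans hyz' (hp.rel_left _ _ _ hzt' htw')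
    have ht' := hR.trans (hp.rel_right _ _ _ hxy' hyz') hzt'
    have h₁ : e ≫ triple hxy hy = triple (hxy'.regularImage f) (hy'.regularImage f) := by
      apply triple_hom_ext <;> simp only [Category.assoc, triple_pt₁, triple_pt₂, triple_pt₃]
      · exact ha₁.symm
      · exact ha₂.symm
      · rw [hb_eq, hbq]
    have h₂ : e ≫ triple ht htw = triple (ht'.regularImage f) (htw'.regularImage f) := by
      apply triple_hom_ext <;> simp only [Category.assoc, triple_pt₁, triple_pt₂, triple_pt₃]
      · rw [triple_eta, haq]
      · exact hb₂.symm
      · exact hb₃.symm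
    rw [← cancel_epi e, ← Category.assoc, ← Category.assoc, h₁, h₂, htr hxy' hy', htr ht' htw',
      hp.assoc _ _ _ _ _ hxy' hyz' hzt' htw' hy' ht']

end Goursat

theorem mainTheorem1 {C : Type u} [Category.{v} C] [Regular C] [IsGoursatCategory C]
    {X Y : C} (f : X ⟶ Y) [IsRegularEpi f] (R S : Goursat.Rel X X)
    (hR : R.IsEquiv) (hS : S.IsEquiv)
    (hRS : ∃ p : pullback R.snd S.fst ⟶ X, Goursat.IsConnector R S p) :
    (R.regularImage f).IsEquiv ∧ (S.regularImage f).IsEquiv ∧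
      ∃ q : pullback (R.regularImage f).snd (S.regularImage f).fst ⟶ Y,
        Goursat.IsConnector (R.regularImage f) (S.regularImage f) q := by
  obtain ⟨p, hp⟩ := hRS
  have := Goursat.isRegularEpi_tripleMap f hR hS
  refine ⟨hR.regularImage f, hS.regularImage f, IsRegularEpi.desc (Goursat.Rel.tripleMap f R S)
    (p ≫ f) ?_, .of_tripleMap_comp f hR hS hp (IsRegularEpi.fac _ _ _)⟩
  -- The two arrows coequalised by `tripleMap` give triples with equal images under `f`.
  have h := IsRegularEpi.w (Goursat.Rel.tripleMap f R S)
  apply hp.comp_congr hR hS f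
  · simpa using congr($h ≫ Goursat.Rel.pt₁ _ _)
  · simpa using congr($h ≫ Goursat.Rel.pt₂ _ _)
  · simpa using congr($h ≫ Goursat.Rel.pt₃ _ _)
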